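/- Let $n,m$ be natural numbers and let $\Omega_1\subset\mathbb{C}^n$ and $\Omega_2\subset\mathbb{C}^m$ be arbitrary bounded domains (nonempty, connected, open and bounded sets). For a real number $p>0$ and a bounded domain $\Omega\subset\mathbb{C}^k$, let $A^p(\Omega)$ denote the complex vector space of all holomorphic functions $\phi$ on $\Omega$ with $$\|\phi\|_p:=\left(\int_{\Omega}|\phi|^p\,d\lambda_k\right)^{1/p}<\infty,$$ where $\lambda_k$ is Lebesgue measure on $\mathbb{C}^k$. Suppose that for some real $p>0$ which is not an even integer there is a linear isometry $T:A^p(\Omega_1)\to A^p(\Omega_2)$, i.e. a surjective $\mathbb{C}$-linear map $T$ with $\|T\phi\|_p=\|\phi\|_p$ for all $\phi\in A^p(\Omega_1)$. Then $n=m$. -/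

import Mathlib

open MeasureTheory

/-- A bounded domain in `ℂⁿ`: a nonempty connected open set that is bounded. -/
structure IsBoundedDomain {n : ℕ} (Ω : Set (Fin n → ℂ)) : Prop where
  isOpen : IsOpen Ω
  isConnected : IsConnected Ω
  isBounded : Bornology.IsBounded Ω

/-- A function on `Ω ⊆ ℂⁿ` is holomorphic if it is complex differentiable on `Ω`
(for open `Ω` the values of the extension outside `Ω` play no role). -/
def IsHolomorphicFun {n : ℕ} (Ω : Set (Fin n → ℂ)) (f : Ω → ℂ) : Prop :=
  DifferentiableOn ℂ (Function.extend Subtype.val f 0) Ω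

/-- Lebesgue measure of `ℂⁿ` on the subset `Ω`: a measurable `A ⊆ Ω` has measure `λ(A)`
(for measurable `Ω`, in particular for open `Ω`). -/
noncomputable def lebesgueOn {n : ℕ} (Ω : Set (Fin n → ℂ)) : Measure Ω :=
  (volume : Measure (Fin n → ℂ)).comap Subtype.val

/-- `A^p(Ω)`: the complex vector space of holomorphic functions on `Ω` whose `L^p`-norm with
respect to Lebesgue measure on `Ω` is finite. -/
def bergmanSpace {n : ℕ} (p : ℝ) (Ω : Set (Fin n → ℂ)) : Submodule ℂ (Ω → ℂ) where
  carrier := {f | IsHolomorphicFun Ω f ∧ MemLp f (ENNReal.ofReal p) (lebesgueOn Ω)}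
  zero_mem' := by
    refine ⟨?_, MemLp.zero⟩
    refine (differentiableOn_const (0 : ℂ)).congr fun z hz => ?_
    exact Subtype.val_injective.extend_apply (0 : Ω → ℂ) 0 ⟨z, hz⟩
  add_mem' := by
    rintro f g ⟨hf, hf'⟩ ⟨hg, hg'⟩
    refine ⟨?_, hf'.add hg'⟩
    refine (DifferentiableOn.add hf hg).congr fun z hz => ?_
    have h := fun u : Ω → ℂ => Subtype.val_injective.extend_apply u 0 ⟨z, hz⟩
    simp only at h
    simp only [Pi.add_apply, h]
  smul_mem' := by
    rintro c f ⟨hf, hf'⟩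
    refine ⟨?_, hf'.const_smul c⟩
    refine (DifferentiableOn.const_smul hf c).congr fun z hz => ?_
    have h := fun u : Ω → ℂ => Subtype.val_injective.extend_apply u 0 ⟨z, hz⟩
    simp only at h
    simp only [Pi.smul_apply, h]

/-- The `L^p`-norm `‖φ‖_p = (∫_Ω |φ|^p dλ)^(1/p)` of an element of `A^p(Ω)`. -/
noncomputable def bergmanNorm {n : ℕ} {p : ℝ} {Ω : Set (Fin n → ℂ)} (φ : bergmanSpace p Ω) : ℝ :=
  (∫ z, ‖(φ : Ω → ℂ) z‖ ^ p ∂(lebesgueOn Ω)) ^ (1 / p)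

/-- `A^p(Ω₁)` and `A^p(Ω₂)` are linearly isometric: there is a surjective complex linear map
between them which preserves the `L^p`-norm. -/
def LinearlyIsometric {n m : ℕ} (p : ℝ) (Ω₁ : Set (Fin n → ℂ)) (Ω₂ : Set (Fin m → ℂ)) : Prop :=
  ∃ T : bergmanSpace p Ω₁ →ₗ[ℂ] bergmanSpace p Ω₂,
    Function.Surjective T ∧ ∀ φ : bergmanSpace p Ω₁, bergmanNorm (T φ) = bergmanNorm φ

open Filter Topology Finset Asymptotics
open scoped FourierTransform RealInnerProductSpace


/-! If the dimensions differ, let `A ⊆ ℂ^a` be the larger-dimensional domain and `B ⊆ ℂ^b` the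
other. Transporting `1, z_1, …, z_a` by the isometry gives `φ₀, φ_i` on `B` with `∫_A |u + ∑ v_i
z_i|^p = ∫_B |u φ₀ + ∑ v_i φ_i|^p` for all `u`, `v`. Off the zeros of `φ₀`, put `G = φ / φ₀` and
weight Lebesgue measure by `|φ₀|^p`. As `p` is not an even integer, such integrals determine the
joint distribution (`map_eq_map_of_integral_norm_rpow_eq`), so Lebesgue measure on `A` is the
pushforward under `G`. But `G` is holomorphic in `b < a` variables, so its image is null
(`volume_image_eq_zero_of_lt`).

For the distribution, high differences in `u` turn `|w|^p` into a continuous integrable kernel,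
nonzero because `p` is not even. Fourier transform in `u` then isolates the characteristic
functions. -/

/-! ### Finite differences of `‖w‖ ^ p`. -/

/-- The `N`-th forward difference, with step `1`, of the function `w ↦ ‖w‖ ^ p` on `ℂ`. -/
noncomputable def normRpowDiff (p : ℝ) (N : ℕ) (w : ℂ) : ℝ :=
  ∑ j ∈ range (N + 1), ((-1 : ℝ) ^ (N - j) * N.choose j) * ‖w + j‖ ^ p

theorem continuous_normRpowDiff {p : ℝ} (hp : 0 < p) (N : ℕ) : Continuous (normRpowDiff p N) := by
  unfold normRpowDiff
  refine continuous_finsetSum _ fun j _ => continuous_const.mul ?_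
  exact (continuous_norm.comp (continuous_id.add continuous_const)).rpow_const
    fun _ => Or.inr hp.le

theorem sum_neg_one_pow_mul_choose_mul_pow_eq_zero {N k : ℕ} (h : k < N) :
    ∑ j ∈ range (N + 1), ((-1 : ℝ) ^ (N - j) * N.choose j) * (j : ℝ) ^ k = 0 := by
  have := congr_fun (fwdDiff_iter_pow_eq_zero_of_lt (R := ℝ) h) 0
  rw [fwdDiff_iter_eq_sum_shift] at this
  simpa using this

theorem analyticAt_norm_one_add_rpow (p : ℝ) :
    AnalyticAt ℝ (fun ζ : ℂ => ‖1 + ζ‖ ^ p) 0 := by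
  have h1 : ContDiffAt ℝ ⊤ (fun ζ : ℂ => ‖1 + ζ‖) 0 :=
    ContDiffAt.norm ℝ (contDiffAt_const.add contDiffAt_id) (by simp)
  have h2 : ContDiffAt ℝ ⊤ (fun ζ : ℂ => ‖1 + ζ‖ ^ p) 0 :=
    h1.rpow_const_of_ne (by simp)
  exact h2.analyticAt

/-- Factor out `‖w‖ ^ p` and Taylor expand `‖1 + j / w‖ ^ p` at `0`: the terms of degree below `N`
are polynomial in `j` and are killed by the difference. -/
theorem normRpowDiff_isBigO (p : ℝ) (N : ℕ) :
    normRpowDiff p N =O[cocompact ℂ] fun w => ‖w‖ ^ (p - N) := by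
  obtain ⟨P, hP⟩ := analyticAt_norm_one_add_rpow p
  have hO := hP.isBigO_sub_partialSum_pow N
  simp only [zero_add] at hO
  have hne : ∀ᶠ w : ℂ in cocompact ℂ, w ≠ 0 :=
    (tendsto_norm_cocompact_atTop.eventually (eventually_gt_atTop 0)).mono
      fun w hw => norm_pos_iff.1 hw
  have hj : ∀ j : ℕ, (fun w : ℂ => ‖1 + (j : ℝ) • w⁻¹‖ ^ p - P.partialSum N ((j : ℝ) • w⁻¹))
      =O[cocompact ℂ] fun w => ‖w‖⁻¹ ^ N := by
    intro j
    have ht : Tendsto (fun w : ℂ => (j : ℝ) • w⁻¹) (cocompact ℂ) (𝓝 0) := by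
      have h : Tendsto (fun w : ℂ => w⁻¹) (cocompact ℂ) (𝓝 0) := by
        rw [← Metric.cobounded_eq_cocompact]
        exact tendsto_inv₀_cobounded
      simpa using h.const_smul (j : ℝ)
    refine (hO.comp_tendsto ht).trans ?_
    refine IsBigO.of_bound ((j : ℝ) ^ N) (Eventually.of_forall fun w => ?_)
    simp [mul_pow]
  have hsum := IsBigO.sum (s := range (N + 1)) fun j _ =>
    (hj j).const_mul_left ((-1 : ℝ) ^ (N - j) * N.choose j)
  have hmul := (isBigO_refl (fun w : ℂ => ‖w‖ ^ p) (cocompact ℂ)).mul hsum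
  refine (hmul.congr' ?_ ?_)
  · filter_upwards [hne] with w hw
    have hz : ∑ j ∈ range (N + 1), ((-1 : ℝ) ^ (N - j) * N.choose j) *
        P.partialSum N ((j : ℝ) • w⁻¹) = 0 := by
      simp only [FormalMultilinearSeries.partialSum, mul_sum]
      rw [sum_comm]
      refine sum_eq_zero fun k hk => ?_
      have : ∀ j : ℕ, (P k fun _ => (j : ℝ) • w⁻¹) = (j : ℝ) ^ k * P k fun _ => w⁻¹ := by
        intro j
        have := (P k).map_smul_univ (fun _ => (j : ℝ)) (fun _ => w⁻¹)
        simpa using this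
      simp only [this, ← mul_assoc]
      rw [← sum_mul, sum_neg_one_pow_mul_choose_mul_pow_eq_zero (mem_range.1 hk), zero_mul]
    simp only [Finset.sum_apply, mul_sub (_ * _ : ℝ), sum_sub_distrib]
    rw [hz, sub_zero, normRpowDiff, mul_sum]
    refine sum_congr rfl fun j _ => ?_
    have : w + j = w * (1 + (j : ℝ) • w⁻¹) := by
      rw [Complex.real_smul]
      push_cast
      field_simp
    rw [this, norm_mul, Real.mul_rpow (norm_nonneg _) (norm_nonneg _)]
    ring
  · filter_upwards [hne] with w hw
    rw [Real.rpow_sub (norm_pos_iff.2 hw), Real.rpow_natCast, inv_pow, div_eq_mul_inv]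

theorem integrable_normRpowDiff {p : ℝ} (hp : 0 < p) {N : ℕ} (hN : p + 2 < N) :
    Integrable (normRpowDiff p N) := by
  refine (continuous_normRpowDiff hp N).locallyIntegrable.integrable_of_isBigO_cocompact
    (g := fun w : ℂ => (1 + ‖w‖) ^ (-((N : ℝ) - p))) ?_ ?_
  · refine (normRpowDiff_isBigO p N).trans (IsBigO.of_bound (2 ^ ((N : ℝ) - p)) ?_)
    filter_upwards [tendsto_norm_cocompact_atTop.eventually (eventually_ge_atTop 1)] with w hw
    have hw0 : 0 < ‖w‖ := by linarith
    rw [Real.norm_of_nonneg (by positivity), Real.norm_of_nonneg (by positivity),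
      Real.rpow_neg (by positivity), ← neg_sub, Real.rpow_neg hw0.le,
      ← div_eq_mul_inv, ← Real.div_rpow (by norm_num) (by positivity),
      ← Real.inv_rpow hw0.le]
    refine Real.rpow_le_rpow (by positivity) ?_ (by linarith)
    rw [inv_eq_one_div, div_le_div_iff₀ hw0 (by positivity)]
    linarith
  · refine (integrable_one_add_norm ?_).integrableAtFilter _
    rw [Complex.finrank_real_complex]
    push_cast
    linarith

theorem exists_polynomial_eval_of_fwdDiff_iter_eq_zero {f : ℤ → ℝ} {N : ℕ}
    (hf : (fwdDiff 1)^[N] f = 0) (y : ℤ) :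
    ∃ Q : Polynomial ℝ, ∀ n : ℕ, f (y + n) = Q.eval (n : ℝ) := by
  have hz : ∀ k, N ≤ k → (fwdDiff 1)^[k] f = 0 := by
    intro k hk
    obtain ⟨d, rfl⟩ := Nat.exists_eq_add_of_le hk
    rw [add_comm, Function.iterate_add_apply, hf]
    exact Function.iterate_fixed (by ext; simp [fwdDiff]) d
  refine ⟨∑ k ∈ range N, Polynomial.C ((k.factorial : ℝ)⁻¹ * (fwdDiff 1)^[k] f y) *
    descPochhammer ℝ k, fun n => ?_⟩
  have h := shift_eq_sum_fwdDiff_iter 1 f n y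
  simp only [nsmul_eq_mul, mul_one] at h
  rw [h, Polynomial.eval_finsetSum]
  have hterm : ∀ k, (n.choose k : ℝ) * (fwdDiff 1)^[k] f y = Polynomial.eval (n : ℝ)
      (Polynomial.C ((k.factorial : ℝ)⁻¹ * (fwdDiff 1)^[k] f y) * descPochhammer ℝ k) := by
    intro k
    rw [Polynomial.eval_mul, Polynomial.eval_C, descPochhammer_eval_eq_descFactorial,
      Nat.descFactorial_eq_factorial_mul_choose]
    push_cast
    have : (k.factorial : ℝ) ≠ 0 := by exact_mod_cast k.factorial_ne_zero
    field_simp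
  rw [sum_congr rfl fun k _ => (hterm k).symm]
  trans ∑ k ∈ range (max N (n + 1)), (n.choose k : ℝ) * (fwdDiff 1)^[k] f y
  · refine sum_subset (range_mono (le_max_right _ _)) fun k _ hk => ?_
    rw [Nat.choose_eq_zero_of_lt (by simpa using hk)]
    simp
  · symm
    refine sum_subset (range_mono (le_max_left _ _)) fun k _ hk => ?_
    rw [hz k (by simpa using hk)]
    simp

theorem polynomial_eq_of_eval_natCast {P Q : Polynomial ℝ}
    (h : ∀ n : ℕ, P.eval (n : ℝ) = Q.eval (n : ℝ)) : P = Q := by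
  refine Polynomial.eq_of_infinite_eval_eq P Q ?_
  refine (Set.infinite_range_of_injective (Nat.cast_injective (R := ℝ))).mono ?_
  rintro _ ⟨n, rfl⟩
  exact h n

/-- Otherwise `|j| ^ p` on the integers would be a polynomial in `j`. It is even, so its degree is
even, and growth forces that degree to be `p`. -/
theorem exists_normRpowDiff_ne_zero {p : ℝ} (hp_not_even : ∀ k : ℤ, p ≠ 2 * (k : ℝ))
    (N : ℕ) : ∃ w, normRpowDiff p N w ≠ 0 := by
  by_contra! hK
  set f : ℤ → ℝ := fun j => |(j : ℝ)| ^ p with hf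
  have hdiff : (fwdDiff 1)^[N] f = 0 := by
    ext y
    have := hK (y : ℂ)
    rw [fwdDiff_iter_eq_sum_shift, Pi.zero_apply, ← this, normRpowDiff]
    refine sum_congr rfl fun j _ => ?_
    have hnorm : ‖(y : ℂ) + j‖ = |((y + j • (1 : ℤ) : ℤ) : ℝ)| := by
      have : (y : ℂ) + j = (((y + j • (1 : ℤ) : ℤ) : ℝ) : ℂ) := by push_cast; simp
      rw [this, Complex.norm_real, Real.norm_eq_abs]
    rw [hnorm, zsmul_eq_mul, hf]
    push_cast
    rfl
  obtain ⟨Q, hQ⟩ := exists_polynomial_eval_of_fwdDiff_iter_eq_zero hdiff 0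
  simp only [zero_add] at hQ
  have hQpow : ∀ n : ℕ, Q.eval (n : ℝ) = (n : ℝ) ^ p := by
    intro n
    rw [← hQ, hf]
    simp
  -- Expanding from base point `-M` gives a polynomial that, shifted, agrees with `Q` on the
  -- naturals; so `Q` also represents `f` at `-M`.
  have hneg : ∀ n : ℕ, Q.eval (-(n : ℝ)) = Q.eval (n : ℝ) := by
    intro M
    obtain ⟨R, hR⟩ := exists_polynomial_eval_of_fwdDiff_iter_eq_zero hdiff (-M)
    have hRQ : R.comp (Polynomial.X + Polynomial.C (M : ℝ)) = Q := by
      refine polynomial_eq_of_eval_natCast fun n => ?_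
      have := hR (n + M)
      rw [Polynomial.eval_comp, ← hQ]
      simp only [Polynomial.eval_add, Polynomial.eval_X, Polynomial.eval_C]
      push_cast at this
      rw [← this]
      congr 1
      ring
    rw [← hRQ]
    have h0 := hR 0
    have h2 := hR (2 * M)
    simp only [Polynomial.eval_comp, Polynomial.eval_add, Polynomial.eval_X, Polynomial.eval_C]
    rw [hf] at h0 h2
    push_cast at h0 h2
    rw [neg_add_cancel, ← two_mul, ← h0, ← h2]
    congr 1
    rw [add_zero, abs_neg]
    congr 1
    ring
  have hQcomp : Q.comp (-Polynomial.X) = Q :=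
    polynomial_eq_of_eval_natCast fun n => by
      rw [Polynomial.eval_comp]
      simpa using hneg n
  have hQ0 : Q ≠ 0 := by
    rintro rfl
    simpa using hQpow 1
  have hlead : Q.leadingCoeff ≠ 0 := Polynomial.leadingCoeff_ne_zero.2 hQ0
  have heven : Even Q.natDegree := by
    have h := congrArg Polynomial.leadingCoeff hQcomp
    rw [Polynomial.leadingCoeff_comp (by simp)] at h
    simp only [Polynomial.leadingCoeff_neg, Polynomial.leadingCoeff_X] at h
    by_contra ho
    rw [Nat.not_even_iff_odd] at ho
    rw [ho.neg_one_pow] at h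
    apply hlead
    linarith
  have hlim : Tendsto (fun n : ℕ => (n : ℝ) ^ (p - Q.natDegree)) atTop (𝓝 Q.leadingCoeff) := by
    have h := Polynomial.isEquivalent_atTop_lead Q
    have h' := (Asymptotics.isEquivalent_iff_tendsto_one
      ((eventually_gt_atTop 0).mono fun x hx => mul_ne_zero hlead (pow_ne_zero _ hx.ne'))).1 h
    have h'' := (h'.comp tendsto_natCast_atTop_atTop).const_mul Q.leadingCoeff
    rw [mul_one] at h''
    refine h''.congr' ?_
    filter_upwards [eventually_gt_atTop 0] with n hn
    have hn' : (0 : ℝ) < n := by exact_mod_cast hn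
    simp only [Function.comp, Pi.div_apply, hQpow]
    rw [Real.rpow_sub hn', Real.rpow_natCast]
    field_simp
  have hpd : p - Q.natDegree = 0 := by
    rcases lt_trichotomy (p - Q.natDegree) 0 with h | h | h
    · have := (tendsto_rpow_neg_atTop (neg_pos.2 h)).comp (tendsto_natCast_atTop_atTop (R := ℝ))
      rw [neg_neg] at this
      exact absurd (tendsto_nhds_unique hlim this) hlead
    · exact h
    · have := (tendsto_rpow_atTop h).comp (tendsto_natCast_atTop_atTop (R := ℝ))
      exact absurd hlim (not_tendsto_nhds_of_tendsto_atTop this _)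
  obtain ⟨k, hk⟩ := heven
  apply hp_not_even k
  rw [hk] at hpd
  push_cast at hpd ⊢
  linarith

/-! ### Fourier analysis and equimeasurability. -/

theorem exists_fourier_ne_zero {K : ℂ → ℂ} (hc : Continuous K) (hi : Integrable K)
    (hK : ∃ w, K w ≠ 0) : ∃ ξ, ξ ≠ 0 ∧ 𝓕 K ξ ≠ 0 := by
  by_contra! h
  have hcF : Continuous (𝓕 K) :=
    VectorFourier.fourierIntegral_continuous Real.continuous_fourierChar continuous_inner hi
  have hF : 𝓕 K = 0 := by
    refine Continuous.ext_on (dense_compl_singleton (0 : ℂ)) hcF continuous_const ?_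
    intro ξ hξ
    exact h ξ hξ
  have hFi : Integrable (𝓕 K) := by
    rw [hF]
    exact integrable_zero _ _ _
  obtain ⟨w, hw⟩ := hK
  apply hw
  rw [← congr_fun (hc.fourierInv_fourier_eq hi hFi) w, hF, Real.fourierInv_eq]
  simp

theorem integral_fourierChar_smul_integral_comp_add {X : Type*} [MeasurableSpace X]
    {μ : Measure X} [IsFiniteMeasure μ] {K : ℂ → ℂ} (hc : Continuous K) (hi : Integrable K)
    {g : X → ℂ} (hg : Measurable g) (ξ : ℂ) :
    ∫ u : ℂ, Real.fourierChar (-⟪u, ξ⟫) • ∫ x, K (u + g x) ∂μ =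
      (∫ x, ((Real.fourierChar ⟪g x, ξ⟫ : Circle) : ℂ) ∂μ) * 𝓕 K ξ := by
  have hcont : Continuous fun u : ℂ => ((Real.fourierChar (-⟪u, ξ⟫) : Circle) : ℂ) :=
    continuous_subtype_val.comp (Real.continuous_fourierChar.comp (by fun_prop))
  have hint : Integrable (Function.uncurry fun (u : ℂ) (x : X) =>
      Real.fourierChar (-⟪u, ξ⟫) • K (u + g x)) (volume.prod μ) := by
    refine (integrable_prod_iff' ?_).2 ⟨Eventually.of_forall fun x => ?_, ?_⟩
    · refine Measurable.aestronglyMeasurable ?_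
      simp only [Function.uncurry_def, Circle.smul_def]
      exact (hcont.measurable.comp measurable_fst).smul
        (hc.measurable.comp (measurable_fst.add (hg.comp measurable_snd)))
    · simp only [Function.uncurry, Circle.smul_def]
      refine (hi.comp_add_right (g x)).bdd_mul (c := 1) hcont.aestronglyMeasurable ?_
      exact Eventually.of_forall fun u => (Circle.norm_coe _).le
    · simp only [Function.uncurry, Circle.norm_smul]
      simp only [integral_add_right_eq_self fun u => ‖K u‖]
      exact integrable_const _
  have hinner : ∀ u : ℂ, Real.fourierChar (-⟪u, ξ⟫) • ∫ x, K (u + g x) ∂μ =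
      ∫ x, Real.fourierChar (-⟪u, ξ⟫) • K (u + g x) ∂μ := by
    intro u
    simp only [Circle.smul_def]
    exact (integral_smul _ _).symm
  rw [integral_congr_ae (Eventually.of_forall hinner), integral_integral_swap hint,
    ← integral_mul_const]
  refine integral_congr_ae (Eventually.of_forall fun x => ?_)
  exact congr_fun (VectorFourier.fourierIntegral_comp_add_right Real.fourierChar volume
    (innerₗ ℂ) K (g x)) ξ

theorem integral_cexp_re_mul_I_eq {p : ℝ} (hp : 0 < p) (hp_not_even : ∀ k : ℤ, p ≠ 2 * (k : ℝ))
    {X Y : Type*} [MeasurableSpace X] [MeasurableSpace Y] {μ : Measure X} {ν : Measure Y}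
    [IsFiniteMeasure μ] [IsFiniteMeasure ν] {f : X → ℂ} {g : Y → ℂ} (hf : Measurable f)
    (hg : Measurable g) (hfi : ∀ u v : ℂ, Integrable (fun x => ‖u + v * f x‖ ^ p) μ)
    (hgi : ∀ u v : ℂ, Integrable (fun y => ‖u + v * g y‖ ^ p) ν) (c : ℂ → ℝ)
    (h : ∀ u v : ℂ, ∫ x, ‖u + v * f x‖ ^ p ∂μ = (∫ y, ‖u + v * g y‖ ^ p ∂ν) + c v) :
    ∫ x, Complex.exp ((f x).re * Complex.I) ∂μ = ∫ y, Complex.exp ((g y).re * Complex.I) ∂ν := by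
  -- The `2` is the real dimension of `ℂ`: the kernel decays like `‖w‖ ^ (p - N)`.
  obtain ⟨N, hN⟩ := exists_nat_gt (p + 2)
  have hN0 : 0 < N := by
    have : (0 : ℝ) < N := by linarith
    exact_mod_cast this
  have hK : ∀ u v : ℂ, ∫ x, (normRpowDiff p N (u + v * f x) : ℂ) ∂μ =
      ∫ y, (normRpowDiff p N (u + v * g y) : ℂ) ∂ν := by
    intro u v
    rw [integral_complex_ofReal, integral_complex_ofReal]
    congr 1
    have hcomm : ∀ (a : ℂ) (j : ℕ), u + a + (j : ℂ) = u + j + a := fun a j => add_right_comm u a j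
    simp only [normRpowDiff, hcomm]
    rw [integral_finsetSum _ fun (j : ℕ) _ => (hfi (u + j) v).const_mul _,
      integral_finsetSum _ fun (j : ℕ) _ => (hgi (u + j) v).const_mul _]
    simp only [integral_const_mul, h, mul_add, sum_add_distrib]
    -- The extra term `c v` does not depend on `u`, so differencing in `u` removes it.
    rw [add_eq_left, ← sum_mul]
    have := sum_neg_one_pow_mul_choose_mul_pow_eq_zero hN0
    simp only [pow_zero, mul_one] at this
    rw [this, zero_mul]
  have hc : Continuous fun w => (normRpowDiff p N w : ℂ) :=
    Complex.continuous_ofReal.comp (continuous_normRpowDiff hp N)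
  have hi : Integrable fun w => (normRpowDiff p N w : ℂ) := (integrable_normRpowDiff hp hN).ofReal
  obtain ⟨w, hw⟩ := exists_normRpowDiff_ne_zero hp_not_even N
  obtain ⟨ξ, hξ, hFξ⟩ := exists_fourier_ne_zero hc hi ⟨w, Complex.ofReal_ne_zero.2 hw⟩
  -- With this scaling, `⟪v * z, ξ⟫ = z.re / (2π)`, so one good frequency `ξ ≠ 0` suffices.
  set v : ℂ := (2 * Real.pi * (starRingEnd ℂ) ξ)⁻¹ with hv
  have hchar : ∀ z : ℂ, ((Real.fourierChar ⟪v * z, ξ⟫ : Circle) : ℂ) =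
      Complex.exp (z.re * Complex.I) := by
    intro z
    have : v * z * (starRingEnd ℂ) ξ = ((2 * Real.pi)⁻¹ : ℝ) * z := by
      have hξ' : (starRingEnd ℂ) ξ ≠ 0 := by simpa using hξ
      rw [hv]
      push_cast
      field_simp
    rw [Real.fourierChar_apply, real_inner_comm, Complex.inner, this,
      Complex.re_ofReal_mul]
    congr 2
    push_cast
    field_simp
  have e1 := integral_fourierChar_smul_integral_comp_add (μ := μ) hc hi (hf.const_mul v) ξ
  have e2 := integral_fourierChar_smul_integral_comp_add (μ := ν) hc hi (hg.const_mul v) ξ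
  simp only [hK] at e1
  have e := mul_right_cancel₀ hFξ (e1.symm.trans e2)
  simpa only [hchar] using e

/-! ### Null images and the contradiction between dimensions. -/

/-- Composing with a coordinate projection `ℂ^a → ℂ^b` gives a map between spaces of equal dimension
whose derivative is everywhere singular. -/
theorem volume_image_eq_zero_of_lt {a b : ℕ} (hab : b < a) {U : Set (Fin b → ℂ)} (hU : IsOpen U)
    {G : (Fin b → ℂ) → Fin a → ℂ} (hG : DifferentiableOn ℂ G U) : volume (G '' U) = 0 := by
  let π : (Fin a → ℂ) →L[ℂ] (Fin b → ℂ) :=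
    ContinuousLinearMap.pi fun i => ContinuousLinearMap.proj (Fin.castLE hab.le i)
  have hπ : Function.Surjective π := by
    intro y
    refine ⟨fun j => if h : j.1 < b then y ⟨j.1, h⟩ else 0, ?_⟩
    ext i
    simp [π]
  have himg : G '' U = (G ∘ π) '' (π ⁻¹' U) := by
    rw [Set.image_comp, Set.image_preimage_eq U hπ]
  rw [himg]
  refine addHaar_image_eq_zero_of_det_fderivWithin_eq_zero volume
    (f' := fun x => ((fderiv ℂ G (π x)).comp π).restrictScalars ℝ) (fun x hx => ?_) fun x _ => ?_
  · have h1 := (hG.differentiableAt (hU.mem_nhds hx)).hasFDerivAt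
    exact ((h1.comp x π.hasFDerivAt).restrictScalars ℝ).hasFDerivWithinAt
  · by_contra hdet
    have hinj : Function.Injective (((fderiv ℂ G (π x)).comp π).restrictScalars ℝ) :=
      (LinearMap.equivOfDetNeZero _ hdet).injective
    have hπ0 : π (Pi.single ⟨b, hab⟩ 1) = 0 := by
      ext i
      simp only [π, ContinuousLinearMap.coe_pi', ContinuousLinearMap.proj_apply, Pi.zero_apply]
      refine Pi.single_eq_of_ne (fun h => ?_) _
      have := congrArg Fin.val h
      simp only [Fin.val_castLE] at this
      exact i.2.ne this
    have h0 : (Pi.single ⟨b, hab⟩ 1 : Fin a → ℂ) = 0 := hinj <| by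
      simp [hπ0]
    have := congr_fun h0 ⟨b, hab⟩
    simp at this

theorem exists_eq_re_sum_mul {a : ℕ} (L : StrongDual ℝ (Fin a → ℂ)) :
    ∃ v : Fin a → ℂ, ∀ w, L w = (∑ i, v i * w i).re := by
  refine ⟨fun i => (L (Pi.single i 1) : ℂ) - L (Pi.single i Complex.I) * Complex.I, fun w => ?_⟩
  conv_lhs => rw [← Finset.univ_sum_single w, map_sum]
  rw [Complex.re_sum]
  refine sum_congr rfl fun i _ => ?_
  have : (Pi.single i (w i) : Fin a → ℂ) = (w i).re • (Pi.single i 1 : Fin a → ℂ) +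
      (w i).im • (Pi.single i Complex.I : Fin a → ℂ) := by
    rw [← Pi.single_smul, ← Pi.single_smul, ← Pi.single_add]
    congr 1
    simp [Complex.re_add_im]
  rw [this, map_add, map_smul, map_smul]
  simp
  ring

/-- Rudin's equimeasurability theorem. -/
theorem map_eq_map_of_integral_norm_rpow_eq {p : ℝ} (hp : 0 < p)
    (hp_not_even : ∀ k : ℤ, p ≠ 2 * (k : ℝ)) {X Y : Type*} [MeasurableSpace X] [MeasurableSpace Y]
    {μ : Measure X} {ν : Measure Y} [IsFiniteMeasure μ] [IsFiniteMeasure ν] {a : ℕ}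
    {F : X → Fin a → ℂ} {G : Y → Fin a → ℂ} (hF : Measurable F) (hG : Measurable G)
    (hFi : ∀ (u : ℂ) (v : Fin a → ℂ), Integrable (fun x => ‖u + ∑ i, v i * F x i‖ ^ p) μ)
    (hGi : ∀ (u : ℂ) (v : Fin a → ℂ), Integrable (fun y => ‖u + ∑ i, v i * G y i‖ ^ p) ν)
    (c : (Fin a → ℂ) → ℝ)
    (h : ∀ (u : ℂ) (v : Fin a → ℂ), ∫ x, ‖u + ∑ i, v i * F x i‖ ^ p ∂μ =
      (∫ y, ‖u + ∑ i, v i * G y i‖ ^ p ∂ν) + c v) : μ.map F = ν.map G := by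
  refine Measure.ext_of_charFunDual (funext fun L => ?_)
  obtain ⟨v, hv⟩ := exists_eq_re_sum_mul L
  have hLm : Continuous fun w : Fin a → ℂ => Complex.exp (L w * Complex.I) := by fun_prop
  rw [charFunDual_apply, charFunDual_apply,
    integral_map hF.aemeasurable hLm.aestronglyMeasurable,
    integral_map hG.aemeasurable hLm.aestronglyMeasurable]
  simp only [hv]
  have hsm : ∀ (s : ℂ) (w : Fin a → ℂ), s * ∑ i, v i * w i = ∑ i, (s • v) i * w i := by
    intro s w
    simp [mul_sum, mul_assoc]
  refine integral_cexp_re_mul_I_eq hp hp_not_even (f := fun x => ∑ i, v i * F x i)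
    (g := fun y => ∑ i, v i * G y i) (by fun_prop) (by fun_prop) (fun u s => ?_) (fun u s => ?_)
    (fun s => c (s • v)) (fun u s => ?_)
  · simp only [hsm]
    exact hFi u _
  · simp only [hsm]
    exact hGi u _
  · simp only [hsm]
    exact h u _

open scoped NNReal in
theorem not_exists_integral_norm_rpow_eq {p : ℝ} (hp : 0 < p)
    (hp_not_even : ∀ k : ℤ, p ≠ 2 * (k : ℝ)) {a b : ℕ} (hab : b < a)
    {A : Set (Fin a → ℂ)} {B : Set (Fin b → ℂ)} (hA : IsOpen A) (hA' : A.Nonempty)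
    (hAb : Bornology.IsBounded A) (hB : IsOpen B) {φ₀ : (Fin b → ℂ) → ℂ}
    {φ : Fin a → (Fin b → ℂ) → ℂ} (hφ₀ : DifferentiableOn ℂ φ₀ B)
    (hφ : ∀ i, DifferentiableOn ℂ (φ i) B) (hφ₀m : Measurable φ₀) (hφm : ∀ i, Measurable (φ i))
    (hAi : ∀ (u : ℂ) (v : Fin a → ℂ), IntegrableOn (fun z => ‖u + ∑ i, v i * z i‖ ^ p) A)
    (hBi : ∀ (u : ℂ) (v : Fin a → ℂ),
      IntegrableOn (fun z => ‖u * φ₀ z + ∑ i, v i * φ i z‖ ^ p) B)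
    (h : ∀ (u : ℂ) (v : Fin a → ℂ), ∫ z in A, ‖u + ∑ i, v i * z i‖ ^ p =
      ∫ z in B, ‖u * φ₀ z + ∑ i, v i * φ i z‖ ^ p) : False := by
  set U : Set (Fin b → ℂ) := B ∩ φ₀ ⁻¹' {0}ᶜ with hUdef
  have hU : IsOpen U := hφ₀.continuousOn.isOpen_inter_preimage hB isOpen_compl_singleton
  have hUB : U ⊆ B := Set.inter_subset_left
  set d : (Fin b → ℂ) → ℝ≥0 := fun z => ‖φ₀ z‖₊ ^ p with hd
  have hdm : Measurable d := hφ₀m.nnnorm.pow_const p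
  set G : (Fin b → ℂ) → Fin a → ℂ := fun z i => φ i z / φ₀ z with hG
  have hGm : Measurable G := measurable_pi_lambda _ fun i => (hφm i).div hφ₀m
  have hGd : DifferentiableOn ℂ G U := by
    refine differentiableOn_pi.2 fun i => ?_
    simp only [hG, div_eq_mul_inv]
    exact ((hφ i).mono hUB).mul ((hφ₀.mono hUB).inv fun z hz => hz.2)
  set ν : Measure (Fin b → ℂ) := (volume.restrict U).withDensity fun z => (d z : ENNReal) with hν
  have hmul : ∀ (u : ℂ) (v : Fin a → ℂ), ∀ z ∈ U, d z • ‖u + ∑ i, v i * G z i‖ ^ p =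
      ‖u * φ₀ z + ∑ i, v i * φ i z‖ ^ p := by
    intro u v z hz
    have hz0 : φ₀ z ≠ 0 := hz.2
    have hz' : u * φ₀ z + ∑ i, v i * φ i z = φ₀ z * (u + ∑ i, v i * G z i) := by
      rw [mul_add, mul_sum, mul_comm u]
      congr 1
      refine sum_congr rfl fun i _ => ?_
      rw [hG]
      field_simp
    rw [hz', norm_mul, Real.mul_rpow (norm_nonneg _) (norm_nonneg _)]
    rfl
  have hνi : ∀ (u : ℂ) (v : Fin a → ℂ), Integrable (fun z => ‖u + ∑ i, v i * G z i‖ ^ p) ν := by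
    intro u v
    rw [hν, integrable_withDensity_iff_integrable_smul hdm]
    exact ((integrableOn_congr_fun (hmul u v) hU.measurableSet).2 ((hBi u v).mono_set hUB))
  have hνint : ∀ (u : ℂ) (v : Fin a → ℂ), ∫ z, ‖u + ∑ i, v i * G z i‖ ^ p ∂ν =
      ∫ z in U, ‖u * φ₀ z + ∑ i, v i * φ i z‖ ^ p := by
    intro u v
    rw [hν, integral_withDensity_eq_integral_smul hdm]
    exact setIntegral_congr_fun hU.measurableSet (hmul u v)
  -- On `B \ U` the function `φ₀` vanishes, so that part of the integral is independent of `u` and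
  -- serves as `c v`.
  have hsplit : ∀ (u : ℂ) (v : Fin a → ℂ), ∫ z in A, ‖u + ∑ i, v i * z i‖ ^ p =
      (∫ z, ‖u + ∑ i, v i * G z i‖ ^ p ∂ν) + ∫ z in B \ U, ‖∑ i, v i * φ i z‖ ^ p := by
    intro u v
    rw [h, hνint, ← integral_inter_add_sdiff hU.measurableSet (hBi u v),
      Set.inter_eq_self_of_subset_right hUB]
    congr 1
    refine setIntegral_congr_fun (hB.measurableSet.diff hU.measurableSet) fun z hz => ?_
    have hz0 : φ₀ z = 0 := by
      by_contra h0
      exact hz.2 ⟨hz.1, h0⟩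
    simp [hz0]
  have hAfin : IsFiniteMeasure (volume.restrict A) :=
    isFiniteMeasure_restrict.2 hAb.measure_lt_top.ne
  have hνfin : IsFiniteMeasure ν := by
    have := hνi 1 0
    simp only [Pi.zero_apply, zero_mul, sum_const_zero, add_zero, norm_one, Real.one_rpow] at this
    exact (integrable_const_iff_isFiniteMeasure one_ne_zero).1 this
  have hmap : volume.restrict A = ν.map G := by
    have := map_eq_map_of_integral_norm_rpow_eq hp hp_not_even (F := id) measurable_id hGm
      (μ := volume.restrict A) (ν := ν) hAi hνi _ hsplit
    rwa [Measure.map_id] at this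
  have hnull := volume_image_eq_zero_of_lt hab hU hGd
  -- A measurable null hull avoids having to show that the image is measurable.
  set E := toMeasurable volume (G '' U) with hE
  have hEm : MeasurableSet E := measurableSet_toMeasurable _ _
  have hE0 : volume E = 0 := by rw [hE, measure_toMeasurable, hnull]
  have hEc : volume.restrict A Eᶜ = 0 := by
    rw [hmap, Measure.map_apply hGm hEm.compl]
    refine withDensity_absolutelyContinuous _ _ ?_
    rw [Measure.restrict_apply (hGm hEm.compl)]
    convert measure_empty (μ := volume)
    refine Set.eq_empty_of_forall_notMem fun z hz => hz.1 ?_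
    exact subset_toMeasurable _ _ ⟨z, hz.2, rfl⟩
  rw [Measure.restrict_apply hEm.compl] at hEc
  refine (hA.measure_pos volume hA').ne' (measure_mono_null (t := E ∪ (Eᶜ ∩ A)) (fun z hz => ?_)
    (measure_union_null hE0 hEc))
  by_cases hzE : z ∈ E
  · exact Or.inl hzE
  · exact Or.inr ⟨hzE, hz⟩

/-! ### Bergman spaces and the isometry. -/

theorem mem_bergmanSpace_of_differentiable {n : ℕ} {p : ℝ} {Ω : Set (Fin n → ℂ)}
    (hΩ : IsBoundedDomain Ω) {f : (Fin n → ℂ) → ℂ} (hf : Differentiable ℂ f) :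
    (fun z : Ω => f z) ∈ bergmanSpace p Ω := by
  refine ⟨?_, ?_⟩
  · refine hf.differentiableOn.congr fun z hz => ?_
    exact Subtype.val_injective.extend_apply (fun z : Ω => f z) 0 ⟨z, hz⟩
  · have hfin : IsFiniteMeasure (lebesgueOn Ω) := by
      refine ⟨?_⟩
      rw [lebesgueOn, Measure.comap_apply _ Subtype.val_injective
        (fun s hs => hΩ.isOpen.measurableSet.subtype_image hs) _ MeasurableSet.univ]
      exact (measure_mono (by simp)).trans_lt hΩ.isBounded.measure_lt_top
    obtain ⟨C, hC⟩ := (hΩ.isBounded.isCompact_closure.image hf.continuous).isBounded.exists_norm_le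
    refine MemLp.of_bound ?_ C (Eventually.of_forall fun z => ?_)
    · exact (hf.continuous.comp continuous_subtype_val).measurable.aestronglyMeasurable
    · exact hC _ ⟨z, subset_closure z.2, rfl⟩

theorem extend_apply_of_mem {n : ℕ} {Ω : Set (Fin n → ℂ)} (f : Ω → ℂ) {z : Fin n → ℂ}
    (hz : z ∈ Ω) : Function.extend Subtype.val f 0 z = f ⟨z, hz⟩ :=
  Subtype.val_injective.extend_apply f 0 ⟨z, hz⟩

theorem measurable_extend_of_mem_bergmanSpace {n : ℕ} {p : ℝ} {Ω : Set (Fin n → ℂ)}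
    (hΩ : IsOpen Ω) (f : bergmanSpace p Ω) :
    Measurable (Function.extend Subtype.val (f : Ω → ℂ) 0) := by
  refine (MeasurableEmbedding.subtype_coe hΩ.measurableSet).measurable_extend ?_ measurable_zero
  have h := continuousOn_iff_continuous_domRestrict.1 f.2.1.continuousOn
  refine Continuous.measurable (h.congr fun z => ?_)
  exact extend_apply_of_mem _ z.2

theorem bergmanNorm_eq_bergmanNorm_iff {n m : ℕ} {p : ℝ} (hp : 0 < p) {Ω₁ : Set (Fin n → ℂ)}
    {Ω₂ : Set (Fin m → ℂ)} (φ : bergmanSpace p Ω₁) (ψ : bergmanSpace p Ω₂) :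
    bergmanNorm φ = bergmanNorm ψ ↔
      ∫ z, ‖(φ : Ω₁ → ℂ) z‖ ^ p ∂(lebesgueOn Ω₁) = ∫ z, ‖(ψ : Ω₂ → ℂ) z‖ ^ p ∂(lebesgueOn Ω₂) :=
  Real.rpow_left_inj (integral_nonneg fun _ => by positivity)
    (integral_nonneg fun _ => by positivity) (by positivity)

theorem integral_lebesgueOn {n : ℕ} {Ω : Set (Fin n → ℂ)} (hΩ : IsOpen Ω)
    (f : (Fin n → ℂ) → ℝ) : ∫ z : Ω, f z ∂(lebesgueOn Ω) = ∫ z in Ω, f z :=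
  integral_subtype_comap hΩ.measurableSet f

theorem integrableOn_norm_rpow_of_mem_bergmanSpace {n : ℕ} {p : ℝ} (hp : 0 < p)
    {Ω : Set (Fin n → ℂ)} (hΩ : IsOpen Ω) (φ : bergmanSpace p Ω) {f : (Fin n → ℂ) → ℂ}
    (hf : ∀ z : Ω, (φ : Ω → ℂ) z = f z) : IntegrableOn (fun z => ‖f z‖ ^ p) Ω := by
  have h := φ.2.2.integrable_norm_rpow (by simpa using hp) ENNReal.ofReal_ne_top
  rw [ENNReal.toReal_ofReal hp.le] at h
  simp only [hf] at h
  exact (integrableOn_iff_comap_subtypeVal hΩ.measurableSet).2 h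

/-- Stated for arbitrary `ψ₀`, `ψ` so that images and preimages under the isometry are both covered.
-/
theorem not_bergmanNorm_eq_of_lt {p : ℝ} (hp : 0 < p)
    (hp_not_even : ∀ k : ℤ, p ≠ 2 * (k : ℝ)) {a b : ℕ} (hab : b < a) {A : Set (Fin a → ℂ)}
    {B : Set (Fin b → ℂ)} (hA : IsBoundedDomain A) (hB : IsBoundedDomain B)
    {e : bergmanSpace p A} {x : Fin a → bergmanSpace p A} (he : ∀ z, (e : A → ℂ) z = 1)
    (hx : ∀ i z, (x i : A → ℂ) z = z.1 i) (ψ₀ : bergmanSpace p B) (ψ : Fin a → bergmanSpace p B)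
    (h : ∀ (u : ℂ) (v : Fin a → ℂ),
      bergmanNorm (u • e + ∑ i, v i • x i) = bergmanNorm (u • ψ₀ + ∑ i, v i • ψ i)) : False := by
  have hcA : ∀ (u : ℂ) (v : Fin a → ℂ) (z : A),
      ((u • e + ∑ i, v i • x i : bergmanSpace p A) : A → ℂ) z = u + ∑ i, v i * z.1 i := by
    intro u v z
    simp [he, hx, Finset.sum_apply]
  have hcB : ∀ (u : ℂ) (v : Fin a → ℂ) (z : B),
      ((u • ψ₀ + ∑ i, v i • ψ i : bergmanSpace p B) : B → ℂ) z =
        u * Function.extend Subtype.val (ψ₀ : B → ℂ) 0 z +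
          ∑ i, v i * Function.extend Subtype.val (ψ i : B → ℂ) 0 z := by
    intro u v z
    simp only [extend_apply_of_mem _ z.2]
    simp [Finset.sum_apply]
  refine not_exists_integral_norm_rpow_eq hp hp_not_even hab hA.isOpen hA.isConnected.nonempty
    hA.isBounded hB.isOpen ψ₀.2.1 (fun i => (ψ i).2.1)
    (measurable_extend_of_mem_bergmanSpace hB.isOpen ψ₀)
    (fun i => measurable_extend_of_mem_bergmanSpace hB.isOpen (ψ i))
    (fun u v => integrableOn_norm_rpow_of_mem_bergmanSpace hp hA.isOpen _ (hcA u v))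
    (fun u v => integrableOn_norm_rpow_of_mem_bergmanSpace hp hB.isOpen _ (hcB u v))
    fun u v => ?_
  have := (bergmanNorm_eq_bergmanNorm_iff hp _ _).1 (h u v)
  simp only [hcA, hcB] at this
  rwa [integral_lebesgueOn hA.isOpen fun z => ‖u + ∑ i, v i * z i‖ ^ p,
    integral_lebesgueOn hB.isOpen fun z => ‖u * Function.extend Subtype.val (ψ₀ : B → ℂ) 0 z +
      ∑ i, v i * Function.extend Subtype.val (ψ i : B → ℂ) 0 z‖ ^ p] at this

theorem mainTheorem9 {n m : ℕ} (Ω₁ : Set (Fin n → ℂ)) (Ω₂ : Set (Fin m → ℂ))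
    (hΩ₁ : IsBoundedDomain Ω₁) (hΩ₂ : IsBoundedDomain Ω₂)
    (p : ℝ) (hp : 0 < p) (hp_not_even : ∀ k : ℤ, p ≠ 2 * (k : ℝ))
    (h : LinearlyIsometric p Ω₁ Ω₂) : n = m := by
  obtain ⟨T, hsurj, hT⟩ := h
  rcases lt_trichotomy n m with hlt | heq | hlt
  · exfalso
    let e : bergmanSpace p Ω₂ := ⟨_, mem_bergmanSpace_of_differentiable hΩ₂
      (differentiable_const 1)⟩
    let x : Fin m → bergmanSpace p Ω₂ := fun i =>
      ⟨_, mem_bergmanSpace_of_differentiable hΩ₂ (differentiable_apply i)⟩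
    -- Here the larger dimension is on the target side, so surjectivity supplies preimages of `1`
    -- and the coordinates.
    obtain ⟨ψ₀, hψ₀⟩ := hsurj e
    choose ψ hψ using fun i => hsurj (x i)
    refine not_bergmanNorm_eq_of_lt hp hp_not_even hlt hΩ₂ hΩ₁ (e := e) (x := x) (fun _ => rfl)
      (fun _ _ => rfl) ψ₀ ψ fun u v => ?_
    rw [← hT]
    simp only [map_add, map_sum, map_smul, hψ₀, hψ]
  · exact heq
  · exfalso
    let e : bergmanSpace p Ω₁ := ⟨_, mem_bergmanSpace_of_differentiable hΩ₁
      (differentiable_const 1)⟩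
    let x : Fin n → bergmanSpace p Ω₁ := fun i =>
      ⟨_, mem_bergmanSpace_of_differentiable hΩ₁ (differentiable_apply i)⟩
    refine not_bergmanNorm_eq_of_lt hp hp_not_even hlt hΩ₁ hΩ₂ (e := e) (x := x) (fun _ => rfl)
      (fun _ _ => rfl) (T e) (fun i => T (x i)) fun u v => ?_
    rw [← hT]
    simp only [map_add, map_sum, map_smul]
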